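/- Let $k\ge 1$ and let $\Lambda$ be a row-finite source-free $k$-graph: a countable small category with a degree functor $d:\Lambda\to\mathbb N^k$ with the factorization property, such that each set $v\Lambda^n=\{\lambda\in\Lambda: r(\lambda)=v,\ d(\lambda)=n\}$ ($v\in\Lambda^0$, $n\in\mathbb N^k$) is finite and nonempty. Let $\Lambda^\infty$ be the space of infinite paths, i.e. degree-preserving functors $x:\Omega_k\to\Lambda$, with the topology generated by the cylinder sets $Z(\lambda)=\{x: x(0,d(\lambda))=\lambda\}$ and its Borel $\sigma$-algebra; let $\sigma^m(x)(p,q)=x(p+m,q+m)$, and let the orbit of $x$ be $\{z\in\Lambda^\infty:\exists\, m,n\in\mathbb N^k,\ \sigma^n(x)=\sigma^m(z)\}$. Let $C^*(\Lambda)$ be the universal $C^*$-algebra generated by a Cuntz–Krieger $\Lambda$-family $\{s_\lambda\}_{\lambda\in\Lambda}$. Let $(X,\mu)$ be a measure space with a $\Lambda$-semibranching function system: measurable sets $D_\lambda\subseteq X$, measurable prefixing maps $\tau_\lambda:D_\lambda\to X$ with measurable ranges $R_\lambda=\tau_\lambda(D_\lambda)$, and measurable coding maps $\tau^m:X\to X$,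 such that (a) for each $m\in\mathbb N^k$ and all $\lambda\ne\nu$ of degree $m$: $0<\mu(D_\lambda)<\infty$, $\mu(R_\lambda)<\infty$, $\mu(R_\lambda\cap R_\nu)=0$, the sets $R_\lambda$ with $d(\lambda)=m$ cover $X$ up to a null set, the Radon–Nikodym derivative $\Phi_\lambda=d(\mu\circ\tau_\lambda)/d\mu$ exists and is strictly positive a.e. on $D_\lambda$, and $\tau^m\circ\tau_\lambda=\mathrm{id}_{D_\lambda}$; (b) $\tau_v=\mathrm{id}$ on $D_v$ for $v\in\Lambda^0$; (c) if $s(\lambda)=r(\nu)$ then $R_\nu\subseteq D_\lambda$ up to a null set and $\tau_\lambda\tau_\nu=\tau_{\lambda\nu}$ a.e. (including agreement of the domains up to a null set); (d) $\tau^m\circ\tau^n=\tau^{m+n}$ for all $m,n\in\mathbb N^k$. Let $\pi$ be the representation of $C^*(\Lambda)$ on $L^2(X,\mu)$ arising from this system, that is, $\pi(s_\lambda)\xi(x)=\chi_{R_\lambda}(x)\,\Phi_\lambda(\tau^{d(\lambda)}(x))^{-1/2}\,\xi(\tau^{d(\lambda)}(x))$, and suppose that $\pi$ is irreducible. Let $y\in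 X$ be an atom of $\mu$, i.e. $\mu(\{y\})>0$. Then there is exactly one infinite path $\phi(y)\in\Lambda^\infty$ with $y\in R_{\phi(y)(0,(n,\dots,n))}$ for all $n\in\mathbb N$. There is a projection-valued measure $P$ on the Borel sets of $\Lambda^\infty$ with $P(Z(\lambda))=\pi(s_\lambda)\pi(s_\lambda)^*$ for all $\lambda\in\Lambda$, and for every such $P$: (1) $\pi$ is purely atomic: there is a Borel set $\Omega\subseteq\Lambda^\infty$ with $P(\Lambda^\infty\setminus\Omega)=0$, $P(\{\omega\})\ne 0$ for all $\omega\in\Omega$, and $\sum_{\omega\in\Omega}P(\{\omega\})=\mathrm{Id}$ in the strong operator topology; (2) $P$ is supported on the orbit of $\phi(y)$: the orbit is a Borel set and $P$ of its complement is $0$. -/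

import Mathlib

open CategoryTheory MeasureTheory
open scoped ENNReal

universe u w

/-- A `k`-graph: a countable small category with a degree functor to `ℕ^k` that has the
factorization property. Morphisms are handled as bundled arrows (`KGraph.Path`); an arrow
`p : a ⟶ b` has source `a` and range `b`, and the composite written `p q` (defined if
`s(p) = r(q)`) is `q ≫ p`. -/
structure KGraph (k : ℕ) where
  Vertex : Type u
  [category : SmallCategory Vertex]
  [countable : Countable (Arrow Vertex)]
  degree : Arrow Vertex → (Fin k → ℕ)
  degree_id : ∀ v : Vertex, degree (Arrow.mk (𝟙 v)) = 0
  degree_comp : ∀ {a b c : Vertex} (f : a ⟶ b) (g : b ⟶ c),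
    degree (Arrow.mk (f ≫ g)) = degree (Arrow.mk g) + degree (Arrow.mk f)
  factorization : ∀ (p : Arrow Vertex) (m n : Fin k → ℕ), degree p = m + n →
    ∃! q : Arrow Vertex × Arrow Vertex, ∃ h : q.1.left = q.2.right,
      Arrow.mk (q.2.hom ≫ eqToHom h.symm ≫ q.1.hom) = p ∧ degree q.1 = m ∧ degree q.2 = n

attribute [instance] KGraph.category KGraph.countable

namespace KGraph

variable {k : ℕ} (Λ : KGraph.{u} k)

/-- The morphisms (finite paths) of `Λ`. -/
abbrev Path : Type u := Arrow Λ.Vertex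

variable {Λ}

/-- The source of a path. -/
def source (p : Λ.Path) : Λ.Vertex := p.left

/-- The range of a path. -/
def range (p : Λ.Path) : Λ.Vertex := p.right

/-- A vertex, identified with its identity morphism. -/
def idPath (v : Λ.Vertex) : Λ.Path := Arrow.mk (𝟙 v)

/-- The composite `p q` of paths with `s(p) = r(q)`. -/
def comp (p q : Λ.Path) (h : source p = range q) : Λ.Path :=
  Arrow.mk (q.hom ≫ eqToHom h.symm ≫ p.hom)

variable (Λ)

/-- `v Λ^n`, the set of paths with range `v` and degree `n`. -/
def pathsTo (v : Λ.Vertex) (n : Fin k → ℕ) : Set Λ.Path :=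
  {p | range p = v ∧ Λ.degree p = n}

/-- Every `v Λ^n` is finite. -/
def RowFinite : Prop := ∀ (v : Λ.Vertex) (n : Fin k → ℕ), (Λ.pathsTo v n).Finite

/-- Every `v Λ^n` is nonempty. -/
def SourceFree : Prop := ∀ (v : Λ.Vertex) (n : Fin k → ℕ), (Λ.pathsTo v n).Nonempty

/-! ### Infinite paths -/

/-- An infinite path: a degree-preserving functor `x : Ω_k → Λ`. The category `Ω_k` has objects
`ℕ^k` and exactly one morphism `(m, n)`, of degree `n - m`, with range `m` and source `n`, for
`m ≤ n`; `segment m n` is the path `x(m, n)`, and the image of the object `m` is the vertex of the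
identity `x(m, m)`. -/
@[ext]
structure InfinitePath where
  segment : ∀ m n : Fin k → ℕ, m ≤ n → Λ.Path
  segment_self : ∀ m, segment m m le_rfl = idPath (range (segment m m le_rfl))
  source_segment : ∀ (l m n : Fin k → ℕ) (hlm : l ≤ m) (hmn : m ≤ n),
    source (segment l m hlm) = range (segment m n hmn)
  segment_comp : ∀ (l m n : Fin k → ℕ) (hlm : l ≤ m) (hmn : m ≤ n),
    comp (segment l m hlm) (segment m n hmn) (source_segment l m n hlm hmn) =
      segment l n (hlm.trans hmn)
  degree_segment : ∀ (m n : Fin k → ℕ) (h : m ≤ n), Λ.degree (segment m n h) = n - m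

variable {Λ}

namespace InfinitePath

/-- The initial segment `x(0, n)`. -/
def initial (x : Λ.InfinitePath) (n : Fin k → ℕ) : Λ.Path := x.segment 0 n (fun _ => Nat.zero_le _)

/-- The shift `σ^m`, given by `σ^m(x)(p, q) = x(p + m, q + m)`. -/
def shift (m : Fin k → ℕ) (x : Λ.InfinitePath) : Λ.InfinitePath where
  segment p q h := x.segment (p + m) (q + m) (add_le_add_left h m)
  segment_self p := x.segment_self (p + m)
  source_segment _ _ _ _ _ := x.source_segment _ _ _ _ _
  segment_comp _ _ _ _ _ := x.segment_comp _ _ _ _ _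
  degree_segment p q h :=
    (x.degree_segment (p + m) (q + m) (add_le_add_left h m)).trans (by
      ext i; exact Nat.add_sub_add_right _ _ _)

/-- The orbit of `x`: all `y` with `σ^n(x) = σ^m(y)` for some `m, n`. -/
def orbit (x : Λ.InfinitePath) : Set Λ.InfinitePath :=
  {y | ∃ m n : Fin k → ℕ, shift n x = shift m y}

end InfinitePath

/-- The cylinder set `Z(p)`. -/
def cylinder (p : Λ.Path) : Set Λ.InfinitePath := {x | x.initial (Λ.degree p) = p}

/-- The topology on the infinite path space generated by the cylinder sets. -/
instance : TopologicalSpace Λ.InfinitePath :=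
  TopologicalSpace.generateFrom (Set.range (cylinder (Λ := Λ)))

instance : MeasurableSpace Λ.InfinitePath := borel _

instance : BorelSpace Λ.InfinitePath := ⟨rfl⟩

/-! ### Cuntz–Krieger families and the C*-algebra of `Λ` -/

/-- A Cuntz–Krieger `Λ`-family in a (not necessarily unital) C*-algebra. For row-finite `Λ`, the
sum in `ck4` is finite. -/
structure IsCuntzKriegerFamily {B : Type w} [NonUnitalCStarAlgebra B] (t : Λ.Path → B) :
    Prop where
  partialIsometry : ∀ p, t p * star (t p) * t p = t p
  ck1_proj : ∀ v, IsStarProjection (t (idPath v))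
  ck1_orth : ∀ v v', v ≠ v' → t (idPath v) * t (idPath v') = 0
  ck2 : ∀ (p q : Λ.Path) (h : source p = range q), t p * t q = t (comp p q h)
  ck3 : ∀ p, star (t p) * t p = t (idPath (source p))
  ck4 : ∀ v n, t (idPath v) = ∑ᶠ p ∈ Λ.pathsTo v n, t p * star (t p)

theorem IsCuntzKriegerFamily.norm_le_one {B : Type w} [NonUnitalCStarAlgebra B]
    {t : Λ.Path → B} (ht : IsCuntzKriegerFamily t) (p : Λ.Path) : ‖t p‖ ≤ 1 := by
  have h1 : ‖star (t p) * t p‖ ≤ 1 := by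
    rw [ht.ck3]
    exact IsStarProjection.norm_le _ (ht.ck1_proj _)
  rw [CStarRing.norm_star_mul_self] at h1
  nlinarith [norm_nonneg (t p)]

variable (Λ)

/-- A Cuntz–Krieger `Λ`-family together with the C*-algebra in which it lives. -/
structure CKModel where
  alg : Type w
  [cstar : NonUnitalCStarAlgebra alg]
  fam : Λ.Path → alg
  isCK : IsCuntzKriegerFamily fam

attribute [instance] CKModel.cstar

/-- The bounded families indexed by all Cuntz–Krieger `Λ`-families, with the supremum norm. -/
abbrev CKProduct : Type (max u (w + 1)) := lp (fun M : CKModel.{u, w} Λ => M.alg) ∞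

/-- The element of the product whose coordinates are the elements `t_p` of all the families. -/
noncomputable def universalFamily (p : Λ.Path) : CKProduct.{u, w} Λ :=
  ⟨fun M => M.fam p, memℓp_infty ⟨1, by rintro _ ⟨M, rfl⟩; exact M.isCK.norm_le_one p⟩⟩

/-- `C*(Λ)`, realized as the C*-algebra generated by the direct sum of all Cuntz–Krieger
`Λ`-families in C*-algebras of a given universe. See `CStar.gen_isCuntzKriegerFamily`,
`CStar.exists_lift` and `CStar.hom_ext` for its universal property. -/
noncomputable def cstarSubalgebra : NonUnitalStarSubalgebra ℂ (CKProduct.{u, w} Λ) :=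
  (NonUnitalStarAlgebra.adjoin ℂ (Set.range (universalFamily.{u, w} Λ))).topologicalClosure

abbrev CStar : Type (max u (w + 1)) := cstarSubalgebra.{u, w} Λ

noncomputable instance : NonUnitalCStarAlgebra (CStar.{u, w} Λ) :=
  haveI : IsClosed (cstarSubalgebra.{u, w} Λ : Set (CKProduct.{u, w} Λ)) :=
    NonUnitalStarSubalgebra.isClosed_topologicalClosure _
  NonUnitalStarSubalgebra.nonUnitalCStarAlgebra _

namespace CStar

variable {Λ}

/-- The generator `s_p` of `C*(Λ)`. -/
noncomputable def gen (p : Λ.Path) : CStar.{u, w} Λ :=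
  ⟨universalFamily Λ p, NonUnitalStarSubalgebra.le_topologicalClosure _
    (NonUnitalStarAlgebra.subset_adjoin ℂ _ ⟨p, rfl⟩)⟩

/-- The coordinate projection of `C*(Λ)` at a given Cuntz–Krieger family. -/
noncomputable def eval (M : CKModel.{u, w} Λ) : CStar.{u, w} Λ →⋆ₙₐ[ℂ] M.alg where
  toFun a := a.1 M
  map_smul' _ _ := rfl
  map_zero' := rfl
  map_add' _ _ := rfl
  map_mul' _ _ := rfl
  map_star' _ := rfl

theorem eval_gen (M : CKModel.{u, w} Λ) (p : Λ.Path) : eval M (gen p) = M.fam p := rfl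

theorem eval_ext {a b : CStar.{u, w} Λ} (h : ∀ M, eval M a = eval M b) : a = b :=
  Subtype.ext (lp.ext (funext h))

theorem gen_isCuntzKriegerFamily (hΛ : Λ.RowFinite) :
    IsCuntzKriegerFamily (gen.{u, w} (Λ := Λ)) where
  partialIsometry p := eval_ext fun M => by
    simpa only [map_mul, map_star, eval_gen] using M.isCK.partialIsometry p
  ck1_proj v := ⟨eval_ext fun M => by
      simpa only [map_mul, eval_gen] using (M.isCK.ck1_proj v).isIdempotentElem.eq,
    eval_ext fun M => by
      simpa only [map_star, eval_gen] using (M.isCK.ck1_proj v).isSelfAdjoint.star_eq⟩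
  ck1_orth v v' h := eval_ext fun M => by
    simpa only [map_mul, map_zero, eval_gen] using M.isCK.ck1_orth v v' h
  ck2 p q h := eval_ext fun M => by
    simpa only [map_mul, eval_gen] using M.isCK.ck2 p q h
  ck3 p := eval_ext fun M => by
    simpa only [map_mul, map_star, eval_gen] using M.isCK.ck3 p
  ck4 v n := eval_ext fun M => by
    have h := M.isCK.ck4 v n
    rw [finsum_mem_eq_finite_toFinset_sum _ (hΛ v n)] at h ⊢
    simpa only [map_sum, map_mul, map_star, eval_gen] using h

theorem exists_lift {B : Type w} [NonUnitalCStarAlgebra B] {t : Λ.Path → B}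
    (ht : IsCuntzKriegerFamily t) : ∃ f : CStar.{u, w} Λ →⋆ₙₐ[ℂ] B, ∀ p, f (gen p) = t p :=
  ⟨eval ⟨B, t, ht⟩, fun _ => rfl⟩

theorem hom_ext {B : Type*} [NonUnitalCStarAlgebra B] {f g : CStar.{u, w} Λ →⋆ₙₐ[ℂ] B}
    (h : ∀ p, f (gen p) = g (gen p)) : f = g := by
  have hadj : ∀ b (hb : b ∈ NonUnitalStarAlgebra.adjoin ℂ (Set.range (universalFamily.{u, w} Λ))),
      f ⟨b, NonUnitalStarSubalgebra.le_topologicalClosure _ hb⟩ =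
        g ⟨b, NonUnitalStarSubalgebra.le_topologicalClosure _ hb⟩ := by
    intro b hb
    induction hb using NonUnitalStarAlgebra.adjoin_induction with
    | mem x hx => obtain ⟨p, rfl⟩ := hx; exact h p
    | add x y hx hy h1 h2 =>
      have e := congrArg₂ (· + ·) h1 h2
      simp only [← map_add] at e
      exact e
    | zero => exact (map_zero f).trans (map_zero g).symm
    | mul x y hx hy h1 h2 =>
      have e := congrArg₂ (· * ·) h1 h2
      simp only [← map_mul] at e
      exact e
    | smul r x hx h1 =>
      have e := congrArg (r • ·) h1
      simp only [← map_smul] at e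
      exact e
    | star x hx h1 =>
      have e := congrArg star h1
      simp only [← map_star] at e
      exact e
  have hcl : IsClosed {a : CStar.{u, w} Λ | f a = g a} :=
    isClosed_eq
      (AddMonoidHomClass.continuous_of_bound f 1 fun a => by
        simpa using NonUnitalStarAlgHom.norm_apply_le f a)
      (AddMonoidHomClass.continuous_of_bound g 1 fun a => by
        simpa using NonUnitalStarAlgHom.norm_apply_le g a)
  ext a
  have ha : a ∈ closure {a : CStar.{u, w} Λ | f a = g a} := by
    rw [closure_subtype]
    have hsub : (NonUnitalStarAlgebra.adjoin ℂ (Set.range (universalFamily.{u, w} Λ)) :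
        Set (CKProduct.{u, w} Λ)) ⊆ Subtype.val '' {a : CStar.{u, w} Λ | f a = g a} :=
      fun b hb => ⟨⟨b, _⟩, hadj b hb, rfl⟩
    exact closure_mono hsub a.2
  exact hcl.closure_subset ha

end CStar

/-! ### Semibranching function systems -/

end KGraph

section Semibranching

variable {X ι : Type*} [MeasurableSpace X]

/-- The measure `μ ∘ σ` on `X`, for an injective map `σ : D → X` on a subset `D` of `X`
(it vanishes off `D`): `E ↦ μ (σ (E ∩ D))`. -/
noncomputable def compMeasure (μ : Measure X) {D : Set X} (σ : D → X) : Measure X :=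
  (Measure.comap σ μ).map Subtype.val

/-- The Radon–Nikodym derivative `d(μ ∘ σ)/dμ`. -/
noncomputable def compDeriv (μ : Measure X) {D : Set X} (σ : D → X) : X → ℝ≥0∞ :=
  (compMeasure μ σ).rnDeriv μ

/-- The family of maps `σ i : D i → X` is a semibranching function system on `(X, μ)`.
Measurability of the ranges, and absolute continuity of `μ ∘ σ i`, are what it means that the
Radon–Nikodym derivatives exist. -/
structure IsSemibranchingFunctionSystem [Countable ι] (μ : Measure X) (D : ι → Set X)
    (σ : ∀ i, D i → X) : Prop where
  measurableSet_domain : ∀ i, MeasurableSet (D i)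
  domain_pos : ∀ i, 0 < μ (D i)
  domain_lt_top : ∀ i, μ (D i) < ∞
  measurable : ∀ i, Measurable (σ i)
  measurableSet_range : ∀ i, MeasurableSet (Set.range (σ i))
  range_lt_top : ∀ i, μ (Set.range (σ i)) < ∞
  cover : μ (⋃ i, Set.range (σ i))ᶜ = 0
  disjoint : ∀ i j, i ≠ j → μ (Set.range (σ i) ∩ Set.range (σ j)) = 0
  absolutelyContinuous : ∀ i, compMeasure μ (σ i) ≪ μ
  deriv_pos : ∀ i, ∀ᵐ x ∂μ, x ∈ D i → 0 < compDeriv μ (σ i) x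

/-- A coding map for the family of maps `σ i : D i → X`. -/
structure IsCodingMap (D : ι → Set X) (σ : ∀ i, D i → X) (c : X → X) : Prop where
  measurable : Measurable c
  leftInverse : ∀ i (x : D i), c (σ i x) = x

end Semibranching

open KGraph

/-- A `Λ`-semibranching function system on `(X, μ)`, with prefixing maps `τ p : D p → X` and
coding maps `coding m : X → X`. In (c), the a.e. equality of the partially defined maps
`τ p ∘ τ q` and `τ (p q)` says that their domains agree up to a null set, and that their values
agree a.e. where both are defined. -/
structure SemibranchingSystem {k : ℕ} (Λ : KGraph.{u} k) {X : Type w} [MeasurableSpace X]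
    (μ : Measure X) where
  D : Λ.Path → Set X
  τ : ∀ p, D p → X
  coding : (Fin k → ℕ) → X → X
  semibranching : ∀ m, IsSemibranchingFunctionSystem μ
    (fun p : {p : Λ.Path // Λ.degree p = m} => D p) (fun p => τ p)
  isCodingMap : ∀ m, IsCodingMap
    (fun p : {p : Λ.Path // Λ.degree p = m} => D p) (fun p => τ p) (coding m)
  τ_id : ∀ (v : Λ.Vertex) (x : D (idPath v)), τ (idPath v) x = x
  range_subset : ∀ p q : Λ.Path, source p = range q → μ (Set.range (τ q) \ D p) = 0
  domain_comp : ∀ (p q : Λ.Path) (h : source p = range q),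
    {x | ∃ hx : x ∈ D q, τ q ⟨x, hx⟩ ∈ D p} =ᵐ[μ] D (comp p q h)
  τ_comp : ∀ (p q : Λ.Path) (h : source p = range q), ∀ᵐ x ∂μ,
    ∀ (hx : x ∈ D q) (hx' : τ q ⟨x, hx⟩ ∈ D p) (hx'' : x ∈ D (comp p q h)),
      τ p ⟨τ q ⟨x, hx⟩, hx'⟩ = τ (comp p q h) ⟨x, hx''⟩
  coding_comp : ∀ m n, coding m ∘ coding n = coding (m + n)

namespace SemibranchingSystem

variable {k : ℕ} {Λ : KGraph.{u} k} {X : Type w} [MeasurableSpace X] {μ : Measure X}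
  (F : SemibranchingSystem Λ μ)

/-- `R_p = τ_p(D_p)`. -/
def R (p : Λ.Path) : Set X := Set.range (F.τ p)

/-- `Φ_p = d(μ ∘ τ_p)/dμ`. -/
noncomputable def Φ (p : Λ.Path) : X → ℝ≥0∞ := compDeriv μ (F.τ p)

/-- The function `S_p ξ (x) = χ_{R_p}(x) (Φ_p(τ^{d(p)}(x)))^{-1/2} ξ(τ^{d(p)}(x))`. -/
noncomputable def prefixFun (p : Λ.Path) (ξ : X → ℂ) : X → ℂ :=
  (F.R p).indicator fun x =>
    (((F.Φ p (F.coding (Λ.degree p) x)).toReal ^ (-(1 / 2) : ℝ) : ℝ) : ℂ) *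
      ξ (F.coding (Λ.degree p) x)

/-- `π` is the representation of `C*(Λ)` on `L²(X, μ)` arising from the system `F`, i.e.
`π(s_p) = S_p` for all `p`. -/
def IsRepresentation
    (π : CStar.{u, w} Λ →⋆ₙₐ[ℂ] (Lp ℂ 2 μ →L[ℂ] Lp ℂ 2 μ)) : Prop :=
  ∀ (p : Λ.Path) (ξ : Lp ℂ 2 μ), π (CStar.gen p) ξ =ᵐ[μ] F.prefixFun p ξ

/-- The points of `X` that are coded by exactly one infinite path, where `x` codes `y` if
`y ∈ R_{x(0, (n, …, n))}` for all `n`. -/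
def codedSet : Set X :=
  {y | ∃! x : Λ.InfinitePath, ∀ n : ℕ, y ∈ F.R (x.initial fun _ => n)}

/-- The map `φ` sending a point to the infinite path that codes it. -/
noncomputable def φ (y : F.codedSet) : Λ.InfinitePath := y.2.choose

end SemibranchingSystem

/-! ### Representations and projection-valued measures -/

section Hilbert

variable {H : Type*} [NormedAddCommGroup H] [InnerProductSpace ℂ H] [CompleteSpace H]

/-- A nonzero representation of a C*-algebra on a Hilbert space is irreducible if it has no
closed invariant subspaces other than `0` and the whole space. -/
def IsIrreducibleRep {A : Type*} [NonUnitalCStarAlgebra A] (π : A →⋆ₙₐ[ℂ] (H →L[ℂ] H)) : Prop :=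
  π ≠ 0 ∧ ∀ K : Submodule ℂ H, IsClosed (K : Set H) →
    (∀ a, ∀ ξ ∈ K, π a ξ ∈ K) → K = ⊥ ∨ K = ⊤

/-- A projection-valued measure; only the values on measurable sets matter. -/
structure ProjectionValuedMeasure (Ω : Type*) [MeasurableSpace Ω] (H : Type*)
    [NormedAddCommGroup H] [InnerProductSpace ℂ H] [CompleteSpace H] where
  proj : Set Ω → H →L[ℂ] H
  isStarProjection : ∀ A, MeasurableSet A → IsStarProjection (proj A)
  proj_univ : proj Set.univ = 1
  proj_inter : ∀ A B, MeasurableSet A → MeasurableSet B → proj (A ∩ B) = proj A * proj B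
  hasSum_iUnion : ∀ A : ℕ → Set Ω, (∀ i, MeasurableSet (A i)) →
    Pairwise (Function.onFun Disjoint A) →
    ∀ ξ, HasSum (fun i => proj (A i) ξ) (proj (⋃ i, A i) ξ)

/-- `P` is purely atomic: there is a Borel set `S` with `P(Sᶜ) = 0`, all of whose points have
nonzero projection, these projections summing to the identity in the strong operator topology. -/
def ProjectionValuedMeasure.IsPurelyAtomic {Ω : Type*} [MeasurableSpace Ω]
    (P : ProjectionValuedMeasure Ω H) : Prop :=
  ∃ S : Set Ω, MeasurableSet S ∧ P.proj Sᶜ = 0 ∧ (∀ x ∈ S, P.proj {x} ≠ 0) ∧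
    ∀ ξ : H, HasSum (fun x : S => P.proj {(x : Ω)} ξ) ξ

/-- `P` is the projection-valued measure on the Borel sets of the infinite path space associated
with the representation `π`: `P(Z(p)) = π(s_p) π(s_p)^*` for all `p`. -/
def IsAssociatedPVM {k : ℕ} {Λ : KGraph.{u} k} (π : CStar.{u, w} Λ →⋆ₙₐ[ℂ] (H →L[ℂ] H))
    (P : ProjectionValuedMeasure Λ.InfinitePath H) : Prop :=
  ∀ p : Λ.Path, P.proj (cylinder p) = π (CStar.gen p) * star (π (CStar.gen p))

end Hilbert

/-! ### Unique factorization of finite paths -/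

namespace KGraph

variable {k : ℕ} {Λ : KGraph.{u} k}

/-! Almost every point `x` of `X` lies, for each degree, in exactly one range `R_p`. These ranges
are nested as `p` grows, so they define an infinite path `f x` with `f⁻¹(Z(p)) = R_p` up to null
sets. The operator `S_p` maps onto the functions in `L²` supported on `R_p`, so `π(s_p)π(s_p)^*` is
multiplication by the indicator of `R_p` (`IsRepresentation.mul_star_eq`). Hence multiplication by
the indicator of `f⁻¹(A)` defines an associated projection-valued measure (`pullbackPVM`). The
cylinders generate the Borel sets, so it is the only one on Borel sets (`proj_eq_of_generateFrom`).

The map `f` turns the coding maps into shifts almost everywhere (`Codes.shift`). An orbit `O` is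
countable, hence Borel, and `z ∈ O` if and only if `σ^m(z) ∈ O`. So `f⁻¹(O)` is invariant under the
coding maps modulo null sets, and its indicator commutes with every `S_p` (`commute_indicatorMul`).
By irreducibility `P(O)` is `0` or `1` (`eq_zero_or_eq_one_of_commute`). When `O` is the orbit of
`φ(y)`, the atom `y` lies in `f⁻¹(O)`, so `P(O) = 1`. Since `O` is countable, countable additivity
then splits the identity into the projections of its points (`isPurelyAtomic_of_countable`). -/

theorem comp_mk {a b c : Λ.Vertex} (f : b ⟶ c) (g : a ⟶ b) :
    comp (Λ := Λ) (Arrow.mk f) (Arrow.mk g) rfl = Arrow.mk (g ≫ f) :=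
  congrArg Arrow.mk (congrArg (g ≫ ·) (Category.id_comp f))

theorem degree_comp_path (p q : Λ.Path) (h : source p = range q) :
    Λ.degree (comp p q h) = Λ.degree p + Λ.degree q := by
  obtain ⟨a, b, f⟩ := p
  obtain ⟨c, e, g⟩ := q
  change a = e at h
  subst h
  exact (congrArg Λ.degree (comp_mk f g)).trans (Λ.degree_comp g f)

theorem source_comp (p q : Λ.Path) (h : source p = range q) : source (comp p q h) = source q := rfl

theorem comp_assoc (p q r : Λ.Path) (h : source p = range q) (h' : source q = range r) :
    comp (comp p q h) r h' = comp p (comp q r h') h := by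
  obtain ⟨a, b, f⟩ := p
  obtain ⟨c, e, g⟩ := q
  obtain ⟨c', e', g'⟩ := r
  change a = e at h
  change c = e' at h'
  subst h h'
  change comp (comp (Arrow.mk f) (Arrow.mk g) rfl) (Arrow.mk g') _ =
    comp (Arrow.mk f) (comp (Arrow.mk g) (Arrow.mk g') rfl) _
  simp only [comp_mk]
  exact congrArg Arrow.mk (Category.assoc _ _ _).symm

theorem comp_idPath (p : Λ.Path) : comp p (idPath (source p)) rfl = p :=
  (comp_mk p.hom _).trans (congrArg Arrow.mk (Category.id_comp _))

theorem idPath_comp (p : Λ.Path) : comp (idPath (range p)) p rfl = p :=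
  (comp_mk _ p.hom).trans (congrArg Arrow.mk (Category.comp_id _))

theorem exists_comp_eq (p : Λ.Path) (m n : Fin k → ℕ) (h : Λ.degree p = m + n) :
    ∃ q r : Λ.Path, ∃ hqr : source q = range r, comp q r hqr = p ∧ Λ.degree q = m ∧
      Λ.degree r = n := by
  obtain ⟨⟨q, r⟩, ⟨hqr, h1, h2⟩, -⟩ := Λ.factorization p m n h
  exact ⟨q, r, hqr, h1, h2⟩

theorem comp_inj {p q p' q' : Λ.Path} {h : source p = range q} {h' : source p' = range q'}
    (hc : comp p q h = comp p' q' h') (hd : Λ.degree p = Λ.degree p') : p = p' ∧ q = q' := by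
  have hq : Λ.degree q = Λ.degree q' := by
    have := congrArg Λ.degree hc
    rw [degree_comp_path, degree_comp_path, hd] at this
    exact add_left_cancel this
  have := (Λ.factorization (comp p q h) _ _ (degree_comp_path p q h)).unique
    (y₁ := (p, q)) (y₂ := (p', q')) ⟨h, rfl, rfl, rfl⟩ ⟨h', hc.symm, hd.symm, hq.symm⟩
  exact ⟨congrArg Prod.fst this, congrArg Prod.snd this⟩

/-- Both `p · id` and `id · p` factor `p` with first factor of degree `0`, so unique factorization
identifies the first factors. -/
theorem eq_idPath_of_degree_eq_zero (p : Λ.Path) (hp : Λ.degree p = 0) :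
    p = idPath (range p) :=
  (comp_inj ((comp_idPath p).trans (idPath_comp p).symm)
    (hp.trans (Λ.degree_id (range p)).symm)).1

/-! ### Infinite paths, orbits and the Borel structure -/

namespace InfinitePath

theorem degree_initial (x : Λ.InfinitePath) (n : Fin k → ℕ) : Λ.degree (x.initial n) = n := by
  rw [initial, degree_segment, tsub_zero]

theorem initial_comp_segment (x : Λ.InfinitePath) (m n : Fin k → ℕ) (h : m ≤ n) :
    comp (x.initial m) (x.segment m n h) (x.source_segment _ _ _ _ _) = x.initial n :=
  x.segment_comp 0 m n _ h

theorem eq_of_initial_eq {x y : Λ.InfinitePath} (h : ∀ n, x.initial n = y.initial n) : x = y := by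
  ext m n hmn : 4
  refine (comp_inj ((x.initial_comp_segment m n hmn).trans
    ((h n).trans (y.initial_comp_segment m n hmn).symm)) ?_).2
  rw [h m]

/-- A compatible family of finite paths of all degrees comes from an infinite path. -/
theorem exists_initial_eq (p : (Fin k → ℕ) → Λ.Path) (hd : ∀ n, Λ.degree (p n) = n)
    (hp : ∀ m n, m ≤ n → ∃ q, ∃ h : source (p m) = range q, comp (p m) q h = p n) :
    ∃ x : Λ.InfinitePath, ∀ n, x.initial n = p n := by
  choose q hq hc using hp
  have hsource : ∀ (m n) (h : m ≤ n), source (q m n h) = source (p n) := fun m n h => by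
    rw [← hc m n h, source_comp]
  have hdeg : ∀ (m n) (h : m ≤ n), Λ.degree (q m n h) = n - m := fun m n h => by
    have := congrArg Λ.degree (hc m n h)
    rw [degree_comp_path, hd, hd] at this
    exact (tsub_eq_of_eq_add_rev this.symm).symm
  -- The segment from `m` to `n` is the cofactor `q` with `p m · q = p n`; functoriality follows by
  -- cancelling `p l` on the left.
  refine ⟨{ segment := q
            segment_self := fun m => eq_idPath_of_degree_eq_zero _ (by rw [hdeg, tsub_self])
            source_segment := fun l m n hlm hmn => (hsource l m hlm).trans (hq m n hmn)
            segment_comp := fun l m n hlm hmn => ?_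
            degree_segment := hdeg }, fun n => ?_⟩
  · have e : comp (comp (p l) (q l m hlm) (hq l m hlm)) (q m n hmn)
        ((hsource l m hlm).trans (hq m n hmn)) = comp (p l) (q l n (hlm.trans hmn)) (hq l n _) := by
      rw [hc l n (hlm.trans hmn)]
      refine Eq.trans ?_ (hc m n hmn)
      congr 1
      exact hc l m hlm
    exact (comp_inj ((comp_assoc _ _ _ _ _).symm.trans e) rfl).2
  · have h0 : p 0 = idPath (range (p 0)) := eq_idPath_of_degree_eq_zero _ (hd 0)
    refine (comp_inj ((idPath_comp _).trans (hc 0 n (fun _ => Nat.zero_le _)).symm) ?_).2.symm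
    rw [hd]
    exact Λ.degree_id _

theorem initial_shift (x : Λ.InfinitePath) (m n : Fin k → ℕ) :
    comp (x.initial m) ((x.shift m).initial n)
      (by have := x.source_segment 0 m (n + m) (fun _ => Nat.zero_le _) (le_add_self)
          simp only [initial, shift, zero_add]; exact this) = x.initial (n + m) := by
  have := x.initial_comp_segment m (n + m) le_add_self
  simp only [initial, shift, zero_add] at this ⊢
  exact this

theorem shift_shift (x : Λ.InfinitePath) (m n : Fin k → ℕ) :
    (x.shift m).shift n = x.shift (n + m) := by
  ext p q h : 4
  simp only [shift, add_assoc]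

theorem eq_of_shift_eq {x y : Λ.InfinitePath} {m : Fin k → ℕ} (hi : x.initial m = y.initial m)
    (hs : x.shift m = y.shift m) : x = y := by
  have key : ∀ n, x.initial (n + m) = y.initial (n + m) := fun n => by
    rw [← initial_shift, ← initial_shift]
    congr 1
    rw [hs]
  refine eq_of_initial_eq fun n => ?_
  have h1 := x.initial_comp_segment n (n + m) le_self_add
  have h2 := y.initial_comp_segment n (n + m) le_self_add
  exact (comp_inj (h1.trans ((key n).trans h2.symm))
    (by rw [degree_initial, degree_initial])).1

theorem mem_orbit_self (x : Λ.InfinitePath) : x ∈ x.orbit := ⟨0, 0, rfl⟩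

theorem shift_mem_orbit_iff (x z : Λ.InfinitePath) (m : Fin k → ℕ) :
    z.shift m ∈ x.orbit ↔ z ∈ x.orbit := by
  constructor
  · rintro ⟨l, n, h⟩
    exact ⟨l + m, n, by rw [h, shift_shift]⟩
  · rintro ⟨l, n, h⟩
    refine ⟨l, m + n, ?_⟩
    rw [← shift_shift, h, shift_shift, shift_shift, add_comm]

/-- A point `z` of the orbit with `σ^n(x) = σ^m(z)` is determined by `m`, `n` and the finite path
`z(0, m)`, and there are countably many such triples. -/
theorem countable_orbit (x : Λ.InfinitePath) : x.orbit.Countable := by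
  have : x.orbit ⊆ ⋃ (m : Fin k → ℕ) (n : Fin k → ℕ) (p : Λ.Path),
      {z | z.initial m = p ∧ x.shift n = z.shift m} := by
    rintro z ⟨m, n, h⟩
    simp only [Set.mem_iUnion]
    exact ⟨m, n, _, rfl, h⟩
  refine Set.Countable.mono this ?_
  refine Set.countable_iUnion fun m => Set.countable_iUnion fun n => Set.countable_iUnion fun p => ?_
  refine Set.Subsingleton.countable ?_
  rintro z ⟨h1, h2⟩ z' ⟨h1', h2'⟩
  exact eq_of_shift_eq (h1.trans h1'.symm) (h2.symm.trans h2')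

theorem isOpen_cylinder (p : Λ.Path) : IsOpen (cylinder p) :=
  TopologicalSpace.isOpen_generateFrom_of_mem ⟨p, rfl⟩

theorem measurableSet_cylinder (p : Λ.Path) : MeasurableSet (cylinder p) :=
  (isOpen_cylinder p).measurableSet

/-- There are only countably many finite paths, so the cylinders form a countable subbasis. -/
theorem borel_eq_generateFrom_cylinder :
    borel Λ.InfinitePath =
      MeasurableSpace.generateFrom (Set.range (cylinder (Λ := Λ))) := by
  have hc : (Set.range (cylinder (Λ := Λ))).Countable := Set.countable_range _
  have : SecondCountableTopology Λ.InfinitePath := ⟨_, hc, rfl⟩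
  exact borel_eq_generateFrom_of_subbasis rfl

theorem measurableSet_singleton (x : Λ.InfinitePath) : MeasurableSet {x} := by
  have : ({x} : Set Λ.InfinitePath) = ⋂ n, cylinder (x.initial n) := by
    ext z
    simp only [Set.mem_singleton_iff, Set.mem_iInter, cylinder, Set.mem_ofPred_eq, degree_initial]
    exact ⟨fun h n => by rw [h], eq_of_initial_eq⟩
  rw [this]
  exact MeasurableSet.iInter fun n => measurableSet_cylinder _

instance : MeasurableSingletonClass Λ.InfinitePath := ⟨measurableSet_singleton⟩

end InfinitePath
end KGraph

/-! ### The measure `μ ∘ σ` -/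

section

variable {X : Type*} [MeasurableSpace X] {μ : Measure X} {D : Set X} {σ : D → X}

theorem comap_eq_zero_of_not {α β : Type*} [MeasurableSpace α] [MeasurableSpace β] {f : α → β}
    {μ : Measure β}
    (h : ¬ (Function.Injective f ∧ ∀ s, MeasurableSet s → NullMeasurableSet (f '' s) μ)) :
    Measure.comap f μ = 0 := dif_neg h

/-- `Measure.comap` takes the default value `0` unless the map is injective with null-measurable
images, so a nonzero value certifies both. -/
theorem nullMeasurableSet_image_of_compMeasure_ne_zero (h : compMeasure μ σ ≠ 0) :
    Function.Injective σ ∧ ∀ s, MeasurableSet s → NullMeasurableSet (σ '' s) μ := by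
  by_contra hn
  exact h (by rw [compMeasure, comap_eq_zero_of_not hn, Measure.map_zero])

theorem compMeasure_apply (h : compMeasure μ σ ≠ 0) {s : Set X} (hs : MeasurableSet s) :
    compMeasure μ σ s = μ (σ '' (Subtype.val ⁻¹' s)) := by
  obtain ⟨hi, hn⟩ := nullMeasurableSet_image_of_compMeasure_ne_zero h
  rw [compMeasure, Measure.map_apply measurable_subtype_coe hs,
    Measure.comap_apply₀ _ _ hi hn (measurable_subtype_coe hs).nullMeasurableSet]

theorem measure_image_eq_zero (h : compMeasure μ σ ≠ 0) (hac : compMeasure μ σ ≪ μ) {s : Set X}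
    (hs : μ s = 0) : μ (σ '' (Subtype.val ⁻¹' s)) = 0 := by
  have h1 := hac ((measure_toMeasurable s).trans hs)
  rw [compMeasure_apply h (measurableSet_toMeasurable _ _)] at h1
  exact measure_mono_null (Set.image_mono (Set.preimage_mono (subset_toMeasurable _ _))) h1

/-- `rnDeriv` is `0` by default when there is no Lebesgue decomposition. A nonzero derivative
excludes this, so no σ-finiteness of `μ` is needed. -/
theorem withDensity_compDeriv (h0 : compDeriv μ σ ≠ 0) (hac : compMeasure μ σ ≪ μ) :
    μ.withDensity (compDeriv μ σ) = compMeasure μ σ := by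
  have : (compMeasure μ σ).HaveLebesgueDecomposition μ := by
    by_contra hn
    exact h0 (Measure.rnDeriv_of_not_haveLebesgueDecomposition hn)
  exact Measure.withDensity_rnDeriv_eq _ _ hac

/-- One half of the change of variables formula for `σ`. -/
theorem lintegral_compMeasure_le (h : compMeasure μ σ ≠ 0) (hσ : Measurable σ) {f g : X → ℝ≥0∞}
    (hf : Measurable f) (hg : Measurable g) (hfg : ∀ x : D, f x = g (σ x)) :
    ∫⁻ x, f x ∂compMeasure μ σ ≤ ∫⁻ x, g x ∂μ := by
  obtain ⟨hi, hn⟩ := nullMeasurableSet_image_of_compMeasure_ne_zero h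
  rw [compMeasure, lintegral_map hf measurable_subtype_coe]
  simp only [hfg]
  rw [← lintegral_map hg hσ]
  -- The pushforward of the comap along `σ` is at most `μ`, because `σ(σ⁻¹(s)) ⊆ s`.
  refine lintegral_mono' (Measure.le_iff.2 fun s hs => ?_) le_rfl
  rw [Measure.map_apply hσ hs, Measure.comap_apply₀ _ _ hi hn (hσ hs).nullMeasurableSet]
  exact measure_mono (Set.image_preimage_subset _ _)

end

/-! ### Coding points of `X` by infinite paths -/

namespace SemibranchingSystem

variable {k : ℕ} {Λ : KGraph.{u} k} {X : Type w} [MeasurableSpace X] {μ : Measure X}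
  (F : SemibranchingSystem Λ μ)

theorem measurableSet_D (p : Λ.Path) : MeasurableSet (F.D p) :=
  (F.semibranching _).measurableSet_domain ⟨p, rfl⟩

theorem measurableSet_R (p : Λ.Path) : MeasurableSet (F.R p) :=
  (F.semibranching _).measurableSet_range ⟨p, rfl⟩

theorem measurable_τ (p : Λ.Path) : Measurable (F.τ p) :=
  (F.semibranching _).measurable ⟨p, rfl⟩

theorem measure_R_lt_top (p : Λ.Path) : μ (F.R p) < ∞ :=
  (F.semibranching _).range_lt_top ⟨p, rfl⟩

theorem coding_τ (p : Λ.Path) (x : F.D p) : F.coding (Λ.degree p) (F.τ p x) = x :=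
  (F.isCodingMap _).leftInverse ⟨p, rfl⟩ x

theorem coding_mem {p : Λ.Path} {x : X} (hx : x ∈ F.R p) : F.coding (Λ.degree p) x ∈ F.D p := by
  obtain ⟨z, rfl⟩ := hx
  rw [coding_τ]
  exact z.2

theorem τ_coding {p : Λ.Path} {x : X} (hx : x ∈ F.R p) :
    F.τ p ⟨F.coding (Λ.degree p) x, F.coding_mem hx⟩ = x := by
  obtain ⟨z, rfl⟩ := hx
  congr 1
  exact Subtype.ext (F.coding_τ p z)

theorem absolutelyContinuous (p : Λ.Path) : compMeasure μ (F.τ p) ≪ μ :=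
  (F.semibranching _).absolutelyContinuous ⟨p, rfl⟩

theorem Φ_pos (p : Λ.Path) : ∀ᵐ x ∂μ, x ∈ F.D p → 0 < F.Φ p x :=
  (F.semibranching _).deriv_pos ⟨p, rfl⟩

theorem Φ_ne_zero (p : Λ.Path) : F.Φ p ≠ 0 := by
  intro h0
  have h1 := F.Φ_pos p
  simp only [h0, Pi.zero_apply, lt_irrefl, imp_false] at h1
  have h2 : μ (F.D p) = 0 := by simpa [ae_iff] using h1
  exact ((F.semibranching _).domain_pos ⟨p, rfl⟩).ne' h2

/-- The derivative of the zero measure vanishes a.e., whereas `Φ_p` is positive a.e. on `D_p`, a set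
of positive measure. -/
theorem compMeasure_ne_zero (p : Λ.Path) : compMeasure μ (F.τ p) ≠ 0 := by
  intro h0
  have h1 := F.Φ_pos p
  have h3 : F.Φ p =ᵐ[μ] 0 := by
    rw [Φ, compDeriv, h0]
    exact Measure.rnDeriv_zero μ
  have h2 : ∀ᵐ x ∂μ, x ∉ F.D p := by
    filter_upwards [h1, h3] with x hx hx' hD
    exact (hx hD).ne' hx'
  exact ((F.semibranching _).domain_pos ⟨p, rfl⟩).ne' (by simpa [ae_iff] using h2)

theorem withDensity_Φ (p : Λ.Path) : μ.withDensity (F.Φ p) = compMeasure μ (F.τ p) :=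
  withDensity_compDeriv (F.Φ_ne_zero p) (F.absolutelyContinuous p)

theorem measurable_Φ (p : Λ.Path) : Measurable (F.Φ p) := Measure.measurable_rnDeriv _ _

theorem Φ_lt_top (p : Λ.Path) : ∀ᵐ x ∂μ, F.Φ p x < ∞ := by
  have : IsFiniteMeasure (compMeasure μ (F.τ p)) := ⟨by
    rw [compMeasure_apply (F.compMeasure_ne_zero p) MeasurableSet.univ, Set.preimage_univ,
      Set.image_univ]
    exact F.measure_R_lt_top p⟩
  exact Measure.rnDeriv_lt_top _ _

/-- The set in question lies in `τ_p(N ∩ D_p)`, which is null because `μ ∘ τ_p ≪ μ`. This lets a.e.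
statements be pulled back along coding maps. -/
theorem measure_R_inter_coding_preimage (p : Λ.Path) {N : Set X} (hN : μ N = 0) :
    μ (F.R p ∩ F.coding (Λ.degree p) ⁻¹' N) = 0 := by
  refine measure_mono_null ?_
    (measure_image_eq_zero (F.compMeasure_ne_zero p) (F.absolutelyContinuous p) hN)
  rintro x ⟨hx, hxN⟩
  exact ⟨_, hxN, F.τ_coding hx⟩

theorem ae_of_mem_R (p : Λ.Path) {Q : X → Prop} (h : ∀ᵐ x ∂μ, Q x) :
    ∀ᵐ x ∂μ, x ∈ F.R p → Q (F.coding (Λ.degree p) x) := by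
  have := F.measure_R_inter_coding_preimage p h
  rw [ae_iff]
  refine measure_mono_null ?_ this
  intro x hx
  simpa using hx

theorem ae_exists_mem_R (m : Fin k → ℕ) : ∀ᵐ x ∂μ, ∃ p : Λ.Path, Λ.degree p = m ∧ x ∈ F.R p := by
  have := (F.semibranching m).cover
  refine measure_mono_null ?_ this
  intro x hx hx'
  obtain ⟨⟨p, hp⟩, hxp⟩ := Set.mem_iUnion.1 hx'
  exact hx ⟨p, hp, hxp⟩

theorem ae_coding {Q : X → Prop} (h : ∀ᵐ x ∂μ, Q x) :
    ∀ᵐ x ∂μ, ∀ m, Q (F.coding m x) := by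
  have h1 : ∀ᵐ x ∂μ, ∀ p, x ∈ F.R p → Q (F.coding (Λ.degree p) x) :=
    ae_all_iff.2 fun p => F.ae_of_mem_R p h
  have h2 := ae_all_iff.2 F.ae_exists_mem_R
  filter_upwards [h1, h2] with x h1 h2 m
  obtain ⟨p, rfl, hp⟩ := h2 m
  exact h1 p hp

theorem ae_eq_of_mem_R (p q : Λ.Path) :
    ∀ᵐ x ∂μ, x ∈ F.R p → x ∈ F.R q → Λ.degree p = Λ.degree q → p = q := by
  by_cases h : p ≠ q ∧ Λ.degree p = Λ.degree q
  · have := (F.semibranching (Λ.degree q)).disjoint ⟨p, h.2⟩ ⟨q, rfl⟩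
      (fun e => h.1 (congrArg Subtype.val e))
    refine measure_mono_null ?_ this
    intro x hx
    by_contra hx'
    exact hx fun hp hq _ => (hx' ⟨hp, hq⟩).elim
  · refine Filter.Eventually.of_forall fun x _ _ hd => ?_
    by_contra hpq
    exact h ⟨hpq, hd⟩

/-- For a.e. `x = τ_{pq}(z)`, the point `z` avoids the exceptional null sets of (c), so `x =
τ_p(τ_q(z))`. -/
theorem ae_mem_R_of_mem_R_comp (p q : Λ.Path) (h : source p = range q) :
    ∀ᵐ x ∂μ, x ∈ F.R (comp p q h) → x ∈ F.R p ∧ F.coding (Λ.degree p) x ∈ F.R q := by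
  have h1 := F.ae_of_mem_R (comp p q h) ((F.domain_comp p q h).mem_iff.and (F.τ_comp p q h))
  filter_upwards [h1] with x hx hxR
  obtain ⟨h2, h3⟩ := hx hxR
  obtain ⟨hq, hp⟩ := h2.2 (F.coding_mem hxR)
  have h4 := (h3 hq hp (F.coding_mem hxR)).trans (F.τ_coding hxR)
  generalize F.coding (Λ.degree (comp p q h)) x = z at hq hp h4
  refine ⟨⟨_, h4⟩, ?_⟩
  rw [← h4, coding_τ]
  exact ⟨_, rfl⟩

/-- The points at which the ranges of the prefixing maps behave like cylinder sets. -/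
def regularSet : Set X :=
  {x | (∀ m, ∃ p : Λ.Path, Λ.degree p = m ∧ x ∈ F.R p) ∧
    (∀ p q : Λ.Path, x ∈ F.R p → x ∈ F.R q → Λ.degree p = Λ.degree q → p = q) ∧
    ∀ (p q : Λ.Path) (h : source p = range q), x ∈ F.R (comp p q h) →
      x ∈ F.R p ∧ F.coding (Λ.degree p) x ∈ F.R q}

theorem ae_mem_regularSet : ∀ᵐ x ∂μ, x ∈ F.regularSet := by
  have h1 := ae_all_iff.2 F.ae_exists_mem_R
  have h2 := ae_all_iff.2 fun p => ae_all_iff.2 fun q => F.ae_eq_of_mem_R p q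
  have h3 := ae_all_iff.2 fun p => ae_all_iff.2 fun q => ae_all_iff.2 fun h =>
    F.ae_mem_R_of_mem_R_comp p q h
  filter_upwards [h1, h2, h3] with x h1 h2 h3 using ⟨h1, h2, h3⟩

/-- The infinite path `z` codes the point `x` by way of all of its initial segments. -/
def Codes (x : X) (z : Λ.InfinitePath) : Prop := ∀ p : Λ.Path, z ∈ cylinder p ↔ x ∈ F.R p

variable {F}

theorem Codes.mem_R {x : X} {z : Λ.InfinitePath} (h : F.Codes x z) (n : Fin k → ℕ) :
    x ∈ F.R (z.initial n) :=
  (h _).1 (congrArg z.initial (z.degree_initial n))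

theorem Codes.unique {x : X} {z z' : Λ.InfinitePath} (h : F.Codes x z) (h' : F.Codes x z') :
    z = z' := by
  refine InfinitePath.eq_of_initial_eq fun n => ?_
  have : z'.initial (Λ.degree (z.initial n)) = z.initial n := (h' _).2 (h.mem_R n)
  rw [z.degree_initial] at this
  exact this.symm

theorem codes_of_forall_mem_R {x : X} (hx : x ∈ F.regularSet) {z : Λ.InfinitePath}
    (h : ∀ n, x ∈ F.R (z.initial n)) : F.Codes x z := fun p =>
  ⟨fun hp => by
    have := h (Λ.degree p)
    rwa [show z.initial (Λ.degree p) = p from hp] at this,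
  fun hp => hx.2.1 _ _ (h _) hp (z.degree_initial _)⟩

theorem codes_of_forall_mem_R_diag {x : X} (hx : x ∈ F.regularSet) {z : Λ.InfinitePath}
    (h : ∀ n : ℕ, x ∈ F.R (z.initial fun _ => n)) : F.Codes x z := by
  refine codes_of_forall_mem_R hx fun n => ?_
  -- Diagonal degrees are cofinal: the sum of the coordinates of `n` bounds each of them.
  have hn : n ≤ fun _ => ∑ i, n i := fun i =>
    Finset.single_le_sum (f := n) (fun _ _ => Nat.zero_le _) (Finset.mem_univ i)
  have h1 := h (∑ i, n i)
  rw [← z.initial_comp_segment n _ hn] at h1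
  exact (hx.2.2 _ _ _ h1).1

theorem exists_codes {x : X} (hx : x ∈ F.regularSet) : ∃ z, F.Codes x z := by
  choose p hd hp using hx.1
  obtain ⟨z, hz⟩ := InfinitePath.exists_initial_eq p hd fun m n hmn => by
    obtain ⟨q, r, h, hc, hq, -⟩ := exists_comp_eq (p n) m (n - m)
      (by rw [hd, add_tsub_cancel_of_le hmn])
    have h1 := hp n
    rw [← hc] at h1
    -- The initial factor of `p n` of degree `m` also has `x` in its range, and a regular point lies
    -- in only one range of each degree.
    have : q = p m := hx.2.1 _ _ (hx.2.2 _ _ _ h1).1 (hp m) (by rw [hq, hd])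
    subst this
    exact ⟨r, h, hc⟩
  exact ⟨z, codes_of_forall_mem_R hx fun n => by rw [hz]; exact hp n⟩

theorem Codes.shift {x : X} {z : Λ.InfinitePath} (hx : x ∈ F.regularSet) (h : F.Codes x z)
    {m : Fin k → ℕ} (hx' : F.coding m x ∈ F.regularSet) :
    F.Codes (F.coding m x) (z.shift m) := by
  refine codes_of_forall_mem_R hx' fun n => ?_
  have h1 := h.mem_R (n + m)
  rw [← InfinitePath.initial_shift] at h1
  have h2 := (hx.2.2 _ _ _ h1).2
  rwa [z.degree_initial] at h2

theorem mem_codedSet_of_mem_regularSet {x : X} (hx : x ∈ F.regularSet) : x ∈ F.codedSet := by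
  obtain ⟨z, hz⟩ := exists_codes hx
  exact ⟨z, fun n => hz.mem_R _, fun z' hz' => (codes_of_forall_mem_R_diag hx hz').unique hz⟩

theorem codes_φ {x : X} (hx : x ∈ F.regularSet) (hx' : x ∈ F.codedSet) : F.Codes x (F.φ ⟨x, hx'⟩) :=
  codes_of_forall_mem_R_diag hx hx'.choose_spec.1

variable (F) in
/-- A Borel map that sends almost every point to the infinite path by which it is coded. -/
theorem exists_measurable_codes [Nonempty Λ.InfinitePath] :
    ∃ f : X → Λ.InfinitePath, Measurable f ∧ ∀ᵐ x ∂μ, F.Codes x (f x) := by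
  classical
  obtain ⟨s, hs, hsm, hs0⟩ := exists_measurable_superset_of_null F.ae_mem_regularSet
  have hreg : ∀ x ∉ s, x ∈ F.regularSet := fun x hx => by
    by_contra hn
    exact hx (hs hn)
  choose! g hg using fun x (hx : x ∈ F.regularSet) => exists_codes hx
  obtain ⟨z₀⟩ := ‹Nonempty Λ.InfinitePath›
  -- The value on the measurable null set `s` is irrelevant; off `s` the preimage of a cylinder is
  -- exactly `R_p`.
  refine ⟨s.piecewise (fun _ => z₀) g, ?_, ?_⟩
  · change @Measurable _ _ _ (borel _) _
    rw [InfinitePath.borel_eq_generateFrom_cylinder]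
    refine measurable_generateFrom ?_
    rintro _ ⟨p, rfl⟩
    have : s.piecewise (fun _ => z₀) g ⁻¹' cylinder p =
        (s ∩ (fun _ => z₀) ⁻¹' cylinder p) ∪ (F.R p \ s) := by
      ext x
      by_cases hx : x ∈ s
      · simp [hx]
      · simpa [hx] using hg x (hreg x hx) p
    rw [this]
    exact (hsm.inter (measurable_const (InfinitePath.measurableSet_cylinder p))).union
      ((F.measurableSet_R p).diff hsm)
  · filter_upwards [measure_eq_zero_iff_ae_notMem.1 hs0] with x hx
    rw [Set.piecewise_eq_of_notMem _ _ _ hx]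
    exact hg x (hreg x hx)

end SemibranchingSystem

/-! ### Multiplication by indicator functions -/

section IndicatorMul

variable {X : Type*} [MeasurableSpace X] {μ : Measure X}

/-- The product of an element of `L²` and the indicator function of a measurable set. -/
noncomputable def indicatorLp {s : Set X} (hs : MeasurableSet s) (ξ : Lp ℂ 2 μ) : Lp ℂ 2 μ :=
  MemLp.toLp (s.indicator ξ) ((Lp.memLp ξ).indicator hs)

theorem coeFn_indicatorLp {s : Set X} (hs : MeasurableSet s) (ξ : Lp ℂ 2 μ) :
    indicatorLp hs ξ =ᵐ[μ] s.indicator ξ := by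
  rw [indicatorLp]
  exact MemLp.coeFn_toLp (f := s.indicator ξ) _

theorem indicatorLp_add {s : Set X} (hs : MeasurableSet s) (ξ η : Lp ℂ 2 μ) :
    indicatorLp hs (ξ + η) = indicatorLp hs ξ + indicatorLp hs η := by
  ext1
  refine (coeFn_indicatorLp hs (ξ + η)).trans (Filter.EventuallyEq.trans ?_
    (Lp.coeFn_add (indicatorLp hs ξ) (indicatorLp hs η)).symm)
  filter_upwards [coeFn_indicatorLp hs ξ, coeFn_indicatorLp hs η, Lp.coeFn_add ξ η]
    with x h3 h4 h5
  rw [Pi.add_apply, h3, h4]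
  by_cases hx : x ∈ s
  · simp only [Set.indicator_of_mem hx, h5, Pi.add_apply]
  · simp only [Set.indicator_of_notMem hx, add_zero]

theorem indicatorLp_smul {s : Set X} (hs : MeasurableSet s) (c : ℂ) (ξ : Lp ℂ 2 μ) :
    indicatorLp hs (c • ξ) = c • indicatorLp hs ξ := by
  ext1
  refine (coeFn_indicatorLp hs (c • ξ)).trans (Filter.EventuallyEq.trans ?_
    (Lp.coeFn_smul c (indicatorLp hs ξ)).symm)
  filter_upwards [coeFn_indicatorLp hs ξ, Lp.coeFn_smul c ξ] with x h3 h4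
  rw [Pi.smul_apply, h3]
  by_cases hx : x ∈ s
  · simp only [Set.indicator_of_mem hx, h4, Pi.smul_apply]
  · simp only [Set.indicator_of_notMem hx, smul_zero]

theorem norm_indicatorLp_le {s : Set X} (hs : MeasurableSet s) (ξ : Lp ℂ 2 μ) :
    ‖indicatorLp hs ξ‖ ≤ 1 * ‖ξ‖ := by
  rw [one_mul]
  refine Lp.norm_le_norm_of_ae_le ?_
  filter_upwards [coeFn_indicatorLp hs ξ] with x hx
  rw [hx]
  exact norm_indicator_le_norm_self _ _

open Classical in
/-- Multiplication on `L²` by the indicator function of a measurable set. -/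
noncomputable def indicatorMul (μ : Measure X) (s : Set X) : Lp ℂ 2 μ →L[ℂ] Lp ℂ 2 μ :=
  if hs : MeasurableSet s then
    LinearMap.mkContinuous
      { toFun := indicatorLp hs
        map_add' := indicatorLp_add hs
        map_smul' := indicatorLp_smul hs } 1 (norm_indicatorLp_le hs)
  else 0

theorem coeFn_indicatorMul {s : Set X} (hs : MeasurableSet s) (ξ : Lp ℂ 2 μ) :
    indicatorMul μ s ξ =ᵐ[μ] s.indicator ξ := by
  rw [indicatorMul, dif_pos hs]
  exact coeFn_indicatorLp hs ξ

theorem indicatorMul_apply_eq_iff {s : Set X} (hs : MeasurableSet s) (ξ : Lp ℂ 2 μ) :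
    indicatorMul μ s ξ = ξ ↔ ∀ᵐ x ∂μ, x ∉ s → ξ x = 0 := by
  constructor
  · intro h
    have h1 := coeFn_indicatorMul hs ξ
    rw [h] at h1
    filter_upwards [h1] with x hx hxs
    rw [hx, Set.indicator_of_notMem hxs]
  · intro h
    ext1
    filter_upwards [coeFn_indicatorMul hs ξ, h] with x h1 h2
    rw [h1]
    by_cases hx : x ∈ s
    · rw [Set.indicator_of_mem hx]
    · rw [Set.indicator_of_notMem hx, h2 hx]

theorem indicatorMul_congr {s t : Set X} (hs : MeasurableSet s) (ht : MeasurableSet t)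
    (h : ∀ᵐ x ∂μ, x ∈ s ↔ x ∈ t) : indicatorMul μ s = indicatorMul μ t := by
  ext1 ξ
  ext1
  filter_upwards [coeFn_indicatorMul hs ξ, coeFn_indicatorMul ht ξ, h] with x h1 h2 h3
  rw [h1, h2]
  by_cases hx : x ∈ s
  · rw [Set.indicator_of_mem hx, Set.indicator_of_mem (h3.1 hx)]
  · rw [Set.indicator_of_notMem hx, Set.indicator_of_notMem fun h => hx (h3.2 h)]

theorem indicatorMul_univ : indicatorMul μ Set.univ = 1 := by
  ext1 ξ
  exact (indicatorMul_apply_eq_iff MeasurableSet.univ ξ).2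
    (Filter.Eventually.of_forall fun x hx => (hx trivial).elim)

theorem indicatorMul_inter {s t : Set X} (hs : MeasurableSet s) (ht : MeasurableSet t) :
    indicatorMul μ (s ∩ t) = indicatorMul μ s * indicatorMul μ t := by
  ext1 ξ
  ext1
  rw [mul_apply_eq_comp]
  filter_upwards [coeFn_indicatorMul (hs.inter ht) ξ, coeFn_indicatorMul ht ξ,
    coeFn_indicatorMul hs (indicatorMul μ t ξ)] with x h1 h2 h3
  rw [h1, h3]
  by_cases hx : x ∈ s <;> by_cases hx' : x ∈ t <;> simp [hx, hx', h2]

theorem isStarProjection_indicatorMul {s : Set X} (hs : MeasurableSet s) :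
    IsStarProjection (indicatorMul μ s) := by
  refine ⟨?_, ?_⟩
  · rw [IsIdempotentElem, ← indicatorMul_inter hs hs, Set.inter_self]
  · rw [ContinuousLinearMap.isSelfAdjoint_iff_isSymmetric]
    intro ξ η
    rw [ContinuousLinearMap.coe_coe, L2.inner_def, L2.inner_def]
    refine integral_congr_ae ?_
    filter_upwards [coeFn_indicatorMul hs ξ, coeFn_indicatorMul hs η] with x h1 h2
    rw [h1, h2]
    by_cases hx : x ∈ s <;> simp [hx]

theorem enorm_indicatorMul_sq {s : Set X} (hs : MeasurableSet s) (ξ : Lp ℂ 2 μ) :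
    ‖indicatorMul μ s ξ‖ₑ ^ 2 = ∫⁻ x in s, ‖ξ x‖ₑ ^ 2 ∂μ := by
  rw [Lp.enorm_def, eLpNorm_congr_ae (coeFn_indicatorMul hs ξ), eLpNorm_indicator_eq_eLpNorm_restrict hs,
    eLpNorm_eq_lintegral_rpow_enorm_toReal (by norm_num) (by norm_num)]
  simp only [ENNReal.toReal_ofNat, ENNReal.rpow_ofNat, one_div]
  rw [← ENNReal.rpow_ofNat, ← ENNReal.rpow_mul]
  norm_num

theorem indicatorMul_union {s t : Set X} (hs : MeasurableSet s) (ht : MeasurableSet t)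
    (h : Disjoint s t) : indicatorMul μ (s ∪ t) = indicatorMul μ s + indicatorMul μ t := by
  ext1 ξ
  ext1
  rw [add_apply]
  filter_upwards [coeFn_indicatorMul (hs.union ht) ξ, coeFn_indicatorMul ht ξ,
    coeFn_indicatorMul hs ξ, Lp.coeFn_add (indicatorMul μ s ξ) (indicatorMul μ t ξ)]
    with x h1 h2 h3 h4
  rw [h1, h4, Pi.add_apply, h2, h3, Set.indicator_union_of_disjoint h]

theorem hasSum_indicatorMul_iUnion {s : ℕ → Set X} (hs : ∀ i, MeasurableSet (s i))
    (hd : Pairwise (Function.onFun Disjoint s)) (ξ : Lp ℂ 2 μ) :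
    HasSum (fun i => indicatorMul μ (s i) ξ) (indicatorMul μ (⋃ i, s i) ξ) := by
  have hfin : ∀ t : Finset ℕ, indicatorMul μ (⋃ i, s i) ξ =
      ∑ i ∈ t, indicatorMul μ (s i) ξ + indicatorMul μ (⋃ i : {i // i ∉ t}, s i) ξ := by
    intro t
    have hfu : ∑ i ∈ t, indicatorMul μ (s i) ξ = indicatorMul μ (⋃ i ∈ t, s i) ξ := by
      induction t using Finset.induction_on with
      | empty =>
        simp only [Finset.sum_empty, Finset.notMem_empty, Set.iUnion_of_empty, Set.iUnion_empty]
        ext1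
        filter_upwards [coeFn_indicatorMul MeasurableSet.empty ξ, Lp.coeFn_zero ℂ 2 μ] with x h1 h2
        rw [h1, h2, Set.indicator_empty, Pi.zero_apply]
      | insert a t ha ih =>
        rw [Finset.sum_insert ha, ih, Finset.set_biUnion_insert, indicatorMul_union (hs a)
          (t.measurableSet_biUnion fun i _ => hs i), add_apply]
        exact Set.disjoint_iUnion₂_right.2 fun i hi => hd (fun e => ha (e ▸ hi))
    rw [hfu, ← add_apply, ← indicatorMul_union
      (t.measurableSet_biUnion fun i _ => hs i)
      (MeasurableSet.iUnion fun i : {i // i ∉ t} => hs i)]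
    · congr 2
      ext x
      simp only [Set.mem_iUnion, Set.mem_union, Subtype.exists]
      constructor
      · rintro ⟨i, hi⟩
        by_cases hit : i ∈ t
        · exact Or.inl ⟨i, hit, hi⟩
        · exact Or.inr ⟨i, hit, hi⟩
      · rintro (⟨i, -, hi⟩ | ⟨i, -, hi⟩) <;> exact ⟨i, hi⟩
    · refine Set.disjoint_iUnion₂_left.2 fun i hi => Set.disjoint_iUnion_right.2 fun j => ?_
      exact hd fun e => j.2 (e ▸ hi)
  have hsum : ∀ t : Set ℕ, ‖indicatorMul μ (⋃ i : t, s i) ξ‖ₑ ^ 2 =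
      ∑' i : t, ‖indicatorMul μ (s i) ξ‖ₑ ^ 2 := by
    intro t
    rw [enorm_indicatorMul_sq (MeasurableSet.iUnion fun i : t => hs i), lintegral_iUnion
      (fun i : t => hs i) fun i j hij => hd fun e => hij (Subtype.ext e)]
    simp only [enorm_indicatorMul_sq (hs _)]
  -- The squared norm of the remainder is a tail of the series of the integrals of `|ξ|²` over the
  -- `s i`, whose sum is finite.
  have htend : Filter.Tendsto (fun t : Finset ℕ => ‖indicatorMul μ (⋃ i : {i // i ∉ t}, s i) ξ‖ₑ ^ 2)
      Filter.atTop (nhds 0) := by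
    have h1 : ∑' i, ‖indicatorMul μ (s i) ξ‖ₑ ^ 2 ≠ ∞ := by
      rw [← tsum_univ, ← hsum]
      exact ENNReal.pow_ne_top enorm_ne_top
    refine (ENNReal.tendsto_tsum_compl_atTop_zero h1).congr fun t => ?_
    exact (hsum {i | i ∉ t}).symm
  rw [HasSum]
  have h2 : Filter.Tendsto (fun t : Finset ℕ => ‖indicatorMul μ (⋃ i : {i // i ∉ t}, s i) ξ‖ ^ 2)
      Filter.atTop (nhds 0) := by
    have := (ENNReal.tendsto_toReal ENNReal.zero_ne_top).comp htend
    simpa [Function.comp_def] using this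
  have h3 := (tendsto_zero_iff_norm_tendsto_zero.2
    (by simpa [Real.sqrt_sq (norm_nonneg _)] using h2.sqrt)).const_sub (indicatorMul μ (⋃ i, s i) ξ)
  rw [sub_zero] at h3
  refine h3.congr fun t => ?_
  rw [hfin t, add_sub_cancel_right]

/-- The projection-valued measure on `L²(X, μ)` given by a measurable map on `X`. -/
noncomputable def pullbackPVM {Ω : Type*} [MeasurableSpace Ω] (μ : Measure X) {f : X → Ω}
    (hf : Measurable f) : ProjectionValuedMeasure Ω (Lp ℂ 2 μ) where
  proj A := indicatorMul μ (f ⁻¹' A)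
  isStarProjection A hA := isStarProjection_indicatorMul (hf hA)
  proj_univ := indicatorMul_univ
  proj_inter A B hA hB := indicatorMul_inter (hf hA) (hf hB)
  hasSum_iUnion A hA hd ξ := by
    rw [Set.preimage_iUnion]
    exact hasSum_indicatorMul_iUnion (fun i => hf (hA i)) (fun i j h => (hd h).preimage f) ξ

end IndicatorMul

/-! ### Projection-valued measures -/

namespace ProjectionValuedMeasure

variable {H : Type*} [NormedAddCommGroup H] [InnerProductSpace ℂ H] [CompleteSpace H]
  {Ω : Type*} [MeasurableSpace Ω] (P Q : ProjectionValuedMeasure Ω H)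

theorem proj_empty : P.proj ∅ = 0 := by
  ext ξ
  have h := P.hasSum_iUnion (fun _ => ∅) (fun _ => MeasurableSet.empty)
    (fun _ _ _ => disjoint_bot_left) ξ
  exact (summable_const_iff _).1 h.summable

theorem hasSum_iUnion_of_countable {ι : Type*} [Countable ι] {A : ι → Set Ω}
    (hA : ∀ i, MeasurableSet (A i)) (hd : Pairwise (Function.onFun Disjoint A)) (ξ : H) :
    HasSum (fun i => P.proj (A i) ξ) (P.proj (⋃ i, A i) ξ) := by
  have := Encodable.ofCountable ι
  have h := P.hasSum_iUnion (fun n => ⋃ i ∈ Encodable.decode₂ ι n, A i)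
    (fun n => MeasurableSet.biUnion (Set.to_countable _) fun i _ => hA i)
    (Encodable.iUnion_decode₂_disjoint_on hd) ξ
  rw [Encodable.iUnion_decode₂] at h
  rw [← (Encodable.encode_injective (α := ι)).hasSum_iff] at h
  · refine h.congr_fun fun i => ?_
    simp only [Function.comp_apply, Encodable.mem_decode₂, Encodable.encode_inj,
      Set.iUnion_iUnion_eq_left]
  · intro n hn
    have : (⋃ i ∈ Encodable.decode₂ ι n, A i) = ∅ :=
      Set.iUnion_eq_empty.2 fun i => Set.iUnion_eq_empty.2 fun hi =>
        (hn ⟨i, Encodable.mem_decode₂.1 hi⟩).elim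
    rw [this, P.proj_empty, zero_apply]

theorem proj_compl {A : Set Ω} (hA : MeasurableSet A) : P.proj Aᶜ = 1 - P.proj A := by
  ext ξ
  have h := P.hasSum_iUnion_of_countable (A := fun b : Bool => cond b A Aᶜ)
    (by rintro (_ | _); exacts [hA.compl, hA])
    (by
      rintro (_ | _) (_ | _) hb
      exacts [(hb rfl).elim, disjoint_compl_left, disjoint_compl_right, (hb rfl).elim]) ξ
  rw [← Set.union_eq_iUnion, Set.union_compl_self, P.proj_univ] at h
  have h' := (hasSum_fintype _).unique h
  rw [Fintype.sum_bool] at h'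
  exact eq_sub_of_add_eq' h'

variable {P Q} in
-- A π-λ argument. `C` need not be closed under intersections, since multiplicativity carries
-- agreement over to the generated π-system.
theorem proj_eq_of_generateFrom {C : Set (Set Ω)} (hC : ‹MeasurableSpace Ω› = .generateFrom C)
    (h : ∀ A ∈ C, P.proj A = Q.proj A) {A : Set Ω} (hA : MeasurableSet A) :
    P.proj A = Q.proj A := by
  have hmeas : ∀ A ∈ generatePiSystem C, MeasurableSet A := 
    generatePiSystem_measurableSet fun B hB => by
      rw [hC]
      exact MeasurableSpace.measurableSet_generateFrom hB
  induction A, hA using MeasurableSpace.induction_on_inter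
    (hC.trans generateFrom_generatePiSystem_eq.symm) (isPiSystem_generatePiSystem C) with
  | empty => rw [proj_empty, proj_empty]
  | basic A hA =>
    induction hA with
    | base hA => exact h _ hA
    | inter hs ht _ ihs iht =>
      rw [P.proj_inter _ _ (hmeas _ hs) (hmeas _ ht), Q.proj_inter _ _ (hmeas _ hs) (hmeas _ ht),
        ihs, iht]
  | compl A hA ih => rw [proj_compl _ hA, proj_compl _ hA, ih]
  | iUnion A hd hA ih =>
    ext ξ
    refine (P.hasSum_iUnion A hA hd ξ).unique ?_
    simp only [ih]
    exact Q.hasSum_iUnion A hA hd ξ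

variable {P} in
/-- A projection-valued measure concentrated on a countable set is purely atomic. -/
theorem isPurelyAtomic_of_countable [MeasurableSingletonClass Ω] {S : Set Ω} (hS : S.Countable)
    (h : P.proj S = 1) : P.IsPurelyAtomic := by
  have hsum : ∀ T : Set Ω, T.Countable → ∀ ξ, HasSum (fun x : T => P.proj {(x : Ω)} ξ)
      (P.proj T ξ) := fun T hT ξ => by
    have := hT.to_subtype
    have h1 := P.hasSum_iUnion_of_countable (A := fun x : T => {(x : Ω)})
      (fun _ => MeasurableSet.singleton _)
      (fun x y hxy => Set.disjoint_singleton.2 fun e => hxy (Subtype.ext e)) ξ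
    rwa [Set.iUnion_singleton_eq_range, Subtype.range_coe] at h1
  -- Points of `S` with zero projection are discarded; the sum does not change.
  have hT : {x ∈ S | P.proj {x} ≠ 0}.Countable := hS.mono fun x hx => hx.1
  have hT1 : ∀ ξ, HasSum (fun x : {x ∈ S | P.proj {x} ≠ 0} => P.proj {(x : Ω)} ξ) ξ := fun ξ => by
    have h1 := hsum S hS ξ
    rw [h] at h1
    refine (hasSum_subtype_iff_indicator (f := fun x => P.proj {x} ξ)).2 ?_
    refine ((hasSum_subtype_iff_indicator (f := fun x => P.proj {x} ξ)).1 h1).congr_fun fun x => ?_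
    by_cases hx : x ∈ S <;> by_cases hx' : P.proj {x} = 0 <;> simp [hx, hx']
  refine ⟨{x ∈ S | P.proj {x} ≠ 0}, hT.measurableSet, ?_, fun x hx => hx.2, hT1⟩
  rw [proj_compl _ hT.measurableSet, sub_eq_zero]
  ext ξ
  exact (hT1 ξ).unique (hsum _ hT ξ)

end ProjectionValuedMeasure

/-! ### Irreducibility and the commutant -/

namespace KGraph.CStar

variable {k : ℕ} {Λ : KGraph.{u} k}

/-- A projection commuting with the images of the generators under an irreducible representation
is trivial. -/
theorem eq_zero_or_eq_one_of_commute {H : Type*} [NormedAddCommGroup H] [InnerProductSpace ℂ H]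
    [CompleteSpace H] {π : CStar.{u, w} Λ →⋆ₙₐ[ℂ] (H →L[ℂ] H)} (hirr : IsIrreducibleRep π)
    {e : H →L[ℂ] H} (he : IsStarProjection e) (hc : ∀ p, Commute e (π (gen p))) :
    e = 0 ∨ e = 1 := by
  -- `U = 1 - 2e` is a self-adjoint unitary, so conjugating `π` by it gives a representation. The
  -- two agree on generators, hence everywhere by `hom_ext`; thus `e` commutes with all of `π`, and
  -- its range `ker (1 - e)` is invariant.
  have hee : e * e = e := he.isIdempotentElem
  have hes : star e = e := he.isSelfAdjoint
  have huu : (1 - (2 : ℂ) • e) * (1 - (2 : ℂ) • e) = 1 := by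
    simp only [sub_mul, mul_sub, one_mul, mul_one, smul_mul_assoc, mul_smul_comm, hee]
    module
  have hus : star (1 - (2 : ℂ) • e) = 1 - (2 : ℂ) • e := by
    simp [hes]
  have hcomm : ∀ a : H →L[ℂ] H, Commute (1 - (2 : ℂ) • e) a → Commute e a := fun a h => by
    have h1 : Commute ((2 : ℂ) • e) a := by
      have := (Commute.one_left a).sub_left h
      rwa [sub_sub_cancel] at this
    have h2 := h1.smul_left (2⁻¹ : ℂ)
    rwa [smul_smul, inv_mul_cancel₀ two_ne_zero, one_smul] at h2
  generalize hu : 1 - (2 : ℂ) • e = U at huu hus hcomm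
  have hUc : ∀ p, Commute U (π (gen p)) := fun p => by
    rw [← hu]
    exact (Commute.one_left _).sub_left ((hc p).smul_left _)
  let g : CStar.{u, w} Λ →⋆ₙₐ[ℂ] (H →L[ℂ] H) :=
    { toFun := fun a => U * π a * U
      map_smul' := fun c a => by simp
      map_zero' := by simp
      map_add' := fun a b => by simp [mul_add, add_mul]
      map_mul' := fun a b => by
        rw [map_mul]
        calc U * (π a * π b) * U = U * π a * (1 * (π b * U)) := by simp only [mul_assoc, one_mul]
          _ = _ := by rw [← huu]; simp only [mul_assoc]
      map_star' := fun a => by simp [hus, mul_assoc, map_star] }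
  have hg : g = π := hom_ext fun p => by
    change U * π (gen p) * U = π (gen p)
    rw [(hUc p).eq, mul_assoc, huu, mul_one]
  have hall : ∀ a, Commute e (π a) := fun a => by
    refine hcomm _ ?_
    have h1 : U * π a * U = π a := DFunLike.congr_fun hg a
    calc U * π a = U * π a * (U * U) := by rw [huu, mul_one]
      _ = π a * U := by rw [← mul_assoc, h1]
  have key := hirr.2 (LinearMap.ker (1 - e : H →L[ℂ] H).toLinearMap)
    (1 - e : H →L[ℂ] H).isClosed_ker (fun a ξ hξ => by
      have hξ' : (1 - e) ξ = 0 := hξ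
      change (1 - e) (π a ξ) = 0
      have h1 : Commute (1 - e) (π a) := (Commute.one_left _).sub_left (hall a)
      rw [← mul_apply_eq_comp, h1.eq, mul_apply_eq_comp, hξ', map_zero])
  rcases key with h | h
  · left
    ext ξ
    have : e ξ ∈ LinearMap.ker (1 - e : H →L[ℂ] H).toLinearMap := by
      change (1 - e) (e ξ) = 0
      rw [← mul_apply_eq_comp, sub_mul, one_mul, hee, sub_self]
      rfl
    rw [h] at this
    exact this
  · right
    ext ξ
    have : ξ ∈ LinearMap.ker (1 - e : H →L[ℂ] H).toLinearMap := by rw [h]; trivial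
    have : (1 - e) ξ = 0 := this
    rw [sub_apply, sub_eq_zero] at this
    exact this.symm

end KGraph.CStar

/-! ### The operators `S_p` -/

namespace SemibranchingSystem

variable {k : ℕ} {Λ : KGraph.{u} k} {X : Type w} [MeasurableSpace X] {μ : Measure X}
  (F : SemibranchingSystem Λ μ)

theorem prefixFun_congr (p : Λ.Path) {ξ η : X → ℂ} (h : ξ =ᵐ[μ] η) :
    F.prefixFun p ξ =ᵐ[μ] F.prefixFun p η := by
  filter_upwards [F.ae_of_mem_R p h] with x hx
  by_cases hR : x ∈ F.R p
  · rw [prefixFun, prefixFun, Set.indicator_of_mem hR, Set.indicator_of_mem hR, hx hR]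
  · rw [prefixFun, prefixFun, Set.indicator_of_notMem hR, Set.indicator_of_notMem hR]

open Classical in
theorem measurable_extend_τ (p : Λ.Path) :
    Measurable fun x => if h : x ∈ F.D p then F.τ p ⟨x, h⟩ else x :=
  Measurable.dite (F.measurable_τ p) measurable_subtype_coe (F.measurableSet_D p)

/-- Every square-integrable function on `R_p` is in the range of the operator `S_p`. -/
theorem exists_prefixFun_eq (p : Λ.Path) (g : Lp ℂ 2 μ) (hg : ∀ᵐ x ∂μ, x ∉ F.R p → g x = 0) :
    ∃ f : Lp ℂ 2 μ, F.prefixFun p f =ᵐ[μ] g := by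
  classical
  have ht := F.measurable_extend_τ p
  set t : X → X := fun x => if h : x ∈ F.D p then F.τ p ⟨x, h⟩ else x with ht_def
  have htD : ∀ x (hx : x ∈ F.D p), t x = F.τ p ⟨x, hx⟩ := fun x hx => dif_pos hx
  have hgm : Measurable (g : X → ℂ) := (Lp.stronglyMeasurable g).measurable
  -- The preimage of `g` under `S_p` is `Φ_p^{1/2} · (g ∘ τ_p)` on `D_p`; its square integral is at
  -- most that of `g` by change of variables.
  set f : X → ℂ := (F.D p).indicator fun x =>
    (((F.Φ p x).toReal ^ (1 / 2 : ℝ) : ℝ) : ℂ) * g (t x) with hf_def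
  have hfm : Measurable f := by
    refine Measurable.indicator ?_ (F.measurableSet_D p)
    exact (Complex.measurable_ofReal.comp ((F.measurable_Φ p).ennreal_toReal.pow_const _)).mul
      (hgm.comp ht)
  set h : X → ℝ≥0∞ := (F.D p).indicator fun x => ‖g (t x)‖ₑ ^ 2 with hh_def
  have hhm : Measurable h :=
    Measurable.indicator ((hgm.comp ht).enorm.pow_const _) (F.measurableSet_D p)
  have hfh : ∀ x, ‖f x‖ₑ ^ 2 ≤ F.Φ p x * h x := fun x => by
    by_cases hx : x ∈ F.D p
    · rw [hf_def, hh_def, Set.indicator_of_mem hx, Set.indicator_of_mem hx, enorm_mul, mul_pow]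
      gcongr
      have h0 : 0 ≤ (F.Φ p x).toReal := ENNReal.toReal_nonneg
      rw [← ofReal_norm, Complex.norm_real, Real.norm_of_nonneg (Real.rpow_nonneg h0 _),
        ← ENNReal.ofReal_pow (Real.rpow_nonneg h0 _), ← Real.sqrt_eq_rpow, Real.sq_sqrt h0]
      exact ENNReal.ofReal_toReal_le
    · rw [hf_def, Set.indicator_of_notMem hx]
      simp
  have hlt : ∫⁻ x, ‖f x‖ₑ ^ 2 ∂μ < ∞ := by
    calc ∫⁻ x, ‖f x‖ₑ ^ 2 ∂μ ≤ ∫⁻ x, F.Φ p x * h x ∂μ := lintegral_mono hfh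
      _ = ∫⁻ x, h x ∂compMeasure μ (F.τ p) := by
        rw [← F.withDensity_Φ, lintegral_withDensity_eq_lintegral_mul _ (F.measurable_Φ p) hhm]
        rfl
      _ ≤ ∫⁻ x, ‖g x‖ₑ ^ 2 ∂μ :=
        lintegral_compMeasure_le (F.compMeasure_ne_zero p) (F.measurable_τ p) hhm
          (hgm.enorm.pow_const _) fun x => by
            rw [hh_def, Set.indicator_of_mem x.2, htD _ x.2]
      _ < ∞ := by
        have := enorm_indicatorMul_sq MeasurableSet.univ g
        rw [Measure.restrict_univ] at this
        rw [← this]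
        exact ENNReal.pow_lt_top enorm_lt_top
  have hmem : MemLp f 2 μ := by
    refine ⟨hfm.aestronglyMeasurable, ?_⟩
    rw [eLpNorm_lt_top_iff_lintegral_rpow_enorm_lt_top (by norm_num) (by norm_num)]
    simpa using hlt
  refine ⟨hmem.toLp f, (F.prefixFun_congr p hmem.coeFn_toLp).trans ?_⟩
  filter_upwards [hg, F.ae_of_mem_R p ((F.Φ_pos p).and (F.Φ_lt_top p))] with x hx hΦ
  by_cases hR : x ∈ F.R p
  · obtain ⟨h1, h2⟩ := hΦ hR
    -- Finiteness of `Φ_p` matters here because `toReal` sends `∞` to `0`.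
    have hpos : 0 < (F.Φ p (F.coding (Λ.degree p) x)).toReal :=
      ENNReal.toReal_pos (h1 (F.coding_mem hR)).ne' h2.ne
    rw [prefixFun, Set.indicator_of_mem hR, hf_def, Set.indicator_of_mem (F.coding_mem hR),
      htD _ (F.coding_mem hR), F.τ_coding hR, ← mul_assoc, ← Complex.ofReal_mul,
      Real.rpow_neg hpos.le, inv_mul_cancel₀ (Real.rpow_pos_of_pos hpos _).ne', Complex.ofReal_one,
      one_mul]
  · rw [prefixFun, Set.indicator_of_notMem hR, hx hR]

variable {F} {π : CStar.{u, w} Λ →⋆ₙₐ[ℂ] (Lp ℂ 2 μ →L[ℂ] Lp ℂ 2 μ)}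

/-- The range projection of `π(s_p)` is multiplication by the indicator function of `R_p`. -/
theorem IsRepresentation.mul_star_eq (hπ : F.IsRepresentation π) (hΛ : Λ.RowFinite) (p : Λ.Path) :
    π (CStar.gen p) * star (π (CStar.gen p)) = indicatorMul μ (F.R p) := by
  have hpi : π (CStar.gen p) * star (π (CStar.gen p)) * π (CStar.gen p) = π (CStar.gen p) := by
    rw [← map_star, ← map_mul, ← map_mul, (CStar.gen_isCuntzKriegerFamily hΛ).partialIsometry]
  have hM : indicatorMul μ (F.R p) * π (CStar.gen p) = π (CStar.gen p) := by
    ext1 ξ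
    refine (indicatorMul_apply_eq_iff (F.measurableSet_R p) _).2 ?_
    filter_upwards [hπ p ξ] with x hx hR
    exact hx.trans (by rw [prefixFun, Set.indicator_of_notMem hR])
  have hEM : π (CStar.gen p) * star (π (CStar.gen p)) * indicatorMul μ (F.R p) =
      indicatorMul μ (F.R p) := by
    ext1 g
    obtain ⟨f, hf⟩ := F.exists_prefixFun_eq p (indicatorMul μ (F.R p) g) <| by
      filter_upwards [coeFn_indicatorMul (F.measurableSet_R p) g] with x hx hR
      rw [hx, Set.indicator_of_notMem hR]
    have hf' : π (CStar.gen p) f = indicatorMul μ (F.R p) g := Lp.ext ((hπ p f).trans hf)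
    rw [mul_apply_eq_comp, ← hf', ← mul_apply_eq_comp, hpi]
  have hs : star (indicatorMul μ (F.R p)) = indicatorMul μ (F.R p) :=
    (isStarProjection_indicatorMul (F.measurableSet_R p)).isSelfAdjoint
  -- With `E = π(s_p)π(s_p)^*` and `M` the multiplication operator, the adjoint of `EM = M` is `ME =
  -- M`, while `ME = E` by `hM`.
  have := congrArg star hEM
  rw [star_mul, star_mul, star_star, hs, ← mul_assoc, hM] at this
  exact this

/-- `S_p(χ_s ξ)` equals `χ_s ∘ τ^{d(p)}` times `S_p ξ`, and invariance replaces `χ_s ∘ τ^{d(p)}` by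
`χ_s`. -/
theorem IsRepresentation.commute_indicatorMul (hπ : F.IsRepresentation π) {s : Set X}
    (hs : MeasurableSet s) (p : Λ.Path)
    (h : ∀ᵐ x ∂μ, F.coding (Λ.degree p) x ∈ s ↔ x ∈ s) :
    Commute (indicatorMul μ s) (π (CStar.gen p)) := by
  ext1 ξ
  rw [mul_apply_eq_comp, mul_apply_eq_comp]
  ext1
  refine ((coeFn_indicatorMul hs _).trans ?_).trans
    ((F.prefixFun_congr p (coeFn_indicatorMul hs ξ)).symm.trans (hπ p _).symm)
  filter_upwards [hπ p ξ, h] with x h1 h2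
  by_cases hx : x ∈ s
  · rw [Set.indicator_of_mem hx, h1, prefixFun, prefixFun]
    by_cases hR : x ∈ F.R p
    · rw [Set.indicator_of_mem hR, Set.indicator_of_mem hR, Set.indicator_of_mem (h2.2 hx)]
    · rw [Set.indicator_of_notMem hR, Set.indicator_of_notMem hR]
  · rw [Set.indicator_of_notMem hx, prefixFun]
    by_cases hR : x ∈ F.R p
    · rw [Set.indicator_of_mem hR, Set.indicator_of_notMem fun h => hx (h2.1 h), mul_zero]
    · rw [Set.indicator_of_notMem hR]

end SemibranchingSystem

/-! ### Atoms and the conclusion -/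

theorem of_ae_of_measure_singleton_pos {X : Type*} [MeasurableSpace X] {μ : Measure X} {y : X}
    (hy : 0 < μ {y}) {Q : X → Prop} (h : ∀ᵐ x ∂μ, Q x) : Q y := by
  by_contra hQ
  -- Monotonicity of the outer measure suffices; `{y}` need not be measurable.
  exact hy.ne' (measure_mono_null (Set.singleton_subset_iff.2 hQ) h)

theorem mainTheorem8 {k : ℕ} (hk : 1 ≤ k) (Λ : KGraph.{u} k) (hrow : Λ.RowFinite)
    (hsrc : Λ.SourceFree) {X : Type w} [MeasurableSpace X] (μ : Measure X)
    (F : SemibranchingSystem Λ μ)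
    (π : CStar.{u, w} Λ →⋆ₙₐ[ℂ] (Lp ℂ 2 μ →L[ℂ] Lp ℂ 2 μ))
    (hπ : F.IsRepresentation π) (hirr : IsIrreducibleRep π)
    (y : X) (hy : 0 < μ {y}) :
    ∃ hcoded : y ∈ F.codedSet,
      (∃ P : ProjectionValuedMeasure Λ.InfinitePath (Lp ℂ 2 μ), IsAssociatedPVM π P) ∧
      ∀ P : ProjectionValuedMeasure Λ.InfinitePath (Lp ℂ 2 μ), IsAssociatedPVM π P →
        P.IsPurelyAtomic ∧
        MeasurableSet (F.φ ⟨y, hcoded⟩).orbit ∧ P.proj (F.φ ⟨y, hcoded⟩).orbitᶜ = 0 := by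
  have hyreg := of_ae_of_measure_singleton_pos hy F.ae_mem_regularSet
  have hcoded := SemibranchingSystem.mem_codedSet_of_mem_regularSet hyreg
  have : Nonempty Λ.InfinitePath := ⟨F.φ ⟨y, hcoded⟩⟩
  obtain ⟨f, hf, hfc⟩ := F.exists_measurable_codes
  have hfy : f y = F.φ ⟨y, hcoded⟩ :=
    (of_ae_of_measure_singleton_pos hy hfc).unique (SemibranchingSystem.codes_φ hyreg hcoded)
  have hQ : IsAssociatedPVM π (pullbackPVM μ hf) := fun p => by
    rw [hπ.mul_star_eq hrow]
    refine indicatorMul_congr (hf (InfinitePath.measurableSet_cylinder p)) (F.measurableSet_R p) ?_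
    filter_upwards [hfc] with x hx using hx p
  refine ⟨hcoded, ⟨_, hQ⟩, fun P hP => ?_⟩
  set O := (F.φ ⟨y, hcoded⟩).orbit with hO
  have hOc : O.Countable := InfinitePath.countable_orbit _
  have hOm : MeasurableSet O := hOc.measurableSet
  have hPO : P.proj O = indicatorMul μ (f ⁻¹' O) :=
    ProjectionValuedMeasure.proj_eq_of_generateFrom (Q := pullbackPVM μ hf)
      InfinitePath.borel_eq_generateFrom_cylinder
      (by rintro _ ⟨p, rfl⟩; exact (hP p).trans (hQ p).symm) hOm
  have hinv : ∀ m, ∀ᵐ x ∂μ, F.coding m x ∈ f ⁻¹' O ↔ x ∈ f ⁻¹' O := fun m => by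
    filter_upwards [F.ae_mem_regularSet, hfc, F.ae_coding (F.ae_mem_regularSet.and hfc)]
      with x h1 h2 h3
    have : f (F.coding m x) = (f x).shift m := (h3 m).2.unique (h2.shift h1 (h3 m).1)
    rw [Set.mem_preimage, Set.mem_preimage, this, hO, InfinitePath.shift_mem_orbit_iff]
  have hne : indicatorMul μ (f ⁻¹' O) ≠ 0 := fun h0 => by
    obtain ⟨p, -, hp⟩ := hyreg.1 0
    -- The test function is the indicator of a range containing `y`, because `{y}` itself need not
    -- be measurable or of finite measure. Equality a.e. forces equality at the atom `y`, giving `0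
    -- = 1`.
    set g := indicatorConstLp 2 (F.measurableSet_R p) (F.measure_R_lt_top p).ne (1 : ℂ)
    have h1 := coeFn_indicatorMul (hf hOm) g
    rw [h0, zero_apply] at h1
    have h2 := of_ae_of_measure_singleton_pos hy
      ((h1.and (Lp.coeFn_zero ℂ 2 μ)).and (indicatorConstLp_coeFn (p := 2)
        (hs := F.measurableSet_R p) (hμs := (F.measure_R_lt_top p).ne) (c := (1 : ℂ))))
    have hyO : y ∈ f ⁻¹' O := by
      rw [Set.mem_preimage, hfy]
      exact InfinitePath.mem_orbit_self _
    rw [h2.1.2, Set.indicator_of_mem hyO, h2.2, Set.indicator_of_mem hp] at h2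
    exact one_ne_zero h2.1.1.symm
  have hone : P.proj O = 1 := by
    rw [hPO]
    exact (CStar.eq_zero_or_eq_one_of_commute hirr (isStarProjection_indicatorMul (hf hOm))
      fun p => hπ.commute_indicatorMul (hf hOm) p (hinv _)).resolve_left hne
  exact ⟨ProjectionValuedMeasure.isPurelyAtomic_of_countable hOc hone, hOm, by
    rw [P.proj_compl hOm, hone, sub_self]⟩
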